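/- Let $\mathbb{T}$ be the unit circle with its normalized Lebesgue measure $m$ ($m(\mathbb{T})=1$), let $\mathbb{D}$ be the open unit disk, and for $1\le p\le\infty$ let $\|\cdot\|_p$ be the norm of $L^p(\mathbb{T},m)$ and let $H^p(\mathbb{T})$ be the space of those complex-valued $f\in L^p(\mathbb{T},m)$ whose harmonic extension (Poisson integral) to $\mathbb{D}$ is analytic in $\mathbb{D}$. Theorem. Let $1<p<\infty$. There is a constant $C_p>0$, depending only on $p$, such that for every $\lambda>0$ and every $f\in H^p(\mathbb{T})$ with $\|f\|_p=1$ there are $f_0\in H^1(\mathbb{T})$ and $f_1\in H^\infty(\mathbb{T})$ with $$f=f_0+f_1,\qquad \|f_1\|_\infty\le\lambda,\qquad \|f_0\|_1\le C_p\,\lambda^{1-p}.$$ -/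

import Mathlib

open MeasureTheory AddCircle
open scoped ENNReal Real

instance fact_two_pi_pos : Fact (0 < 2 * π) := ⟨Real.two_pi_pos⟩

noncomputable section

/-- The harmonic extension (Poisson integral) to the unit disk of a function `f` on the unit
circle. The circle is parametrized by the angle `t` modulo `2π`, its point being `e ^ (it)`, and
carries its Lebesgue measure normalized to total mass one. -/
def harmonicExtension (f : AddCircle (2 * π) → ℂ) (w : ℂ) : ℂ :=
  ∫ t, (poissonKernel 0 w (toCircle t : ℂ) : ℂ) * f t ∂haarAddCircle

/-- Membership in the Hardy space `H ^ p` of the unit circle, for `1 ≤ p ≤ ∞`: the functions in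
`L ^ p` whose harmonic extension is analytic in the open unit disk. -/
def MemHardy (p : ℝ≥0∞) (f : AddCircle (2 * π) → ℂ) : Prop :=
  MemLp f p haarAddCircle ∧ DifferentiableOn ℂ (harmonicExtension f) (Metric.ball 0 1)

end

/-!
Multiply `f` by bounded analytic functions. Put `μ = λ / 3` and `β = √(max (|f| / μ) 1) - 1 ≥ 0`.
Then `β ∈ L²`, with `∫ β² ≤ ∫ (|f| / μ) ^ p = μ ^ (-p)`. Let `E` be the analytic function with real
part `β` (`exists_analytic_completion`), so that `∫ |E|² ≤ 4 ∫ β²`, and let `G = 1 / (1 + E)`. As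
`|1 + E| ≥ 1 + β`, there are the bounds `|G| ≤ 1` and `|f| |G|² ≤ μ`. The decomposition is

* `f₁ = (2 G² - G⁴) f`, of absolute value at most `3 μ = λ`;
* `f₀ = (1 - G²)² f`. Since `|1 - G²| ≤ 2 min(1, |E|)`, this is at most `4 μ |E|²` where
  `|f| ≤ μ`, and at most `4 |f| ≤ 4 μ (|f| / μ) ^ p` elsewhere; both integrals are bounded by a
  constant times `μ ^ (1 - p)`.

The point of squaring `1 - G²` is that `f₀` is quadratically small in `E` where `|f| ≤ μ`, so that
the boundedness of the conjugation operator on `L²` is enough for every `p`, and this is Parseval's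
identity.

It remains to see that `f₁` and `f₀` are analytic. In terms of Fourier coefficients, analyticity of
the harmonic extension means that the negative ones vanish
(`differentiableOn_harmonicExtension_iff`). The extension of `E` to the disk has nonnegative real
part because the Poisson kernel is positive, so `G ^ k` is the boundary function of a holomorphic
function bounded by `1`. Its dilates are absolutely convergent power series on the circle, which
multiply analytic functions into analytic functions, and they converge to `G ^ k` almost everywhere
along a sequence of radii; dominated convergence gives the analyticity of `G ^ k f`
(`negFourierVanish_inv_pow_mul`).
-/

open scoped ComplexConjugate
open Filter Topology

/-! ### Fourier coefficients and power series on the circle -/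

@[simp]
lemma norm_toCircle (t : AddCircle (2 * π)) : ‖(toCircle t : ℂ)‖ = 1 := Circle.norm_coe _

/-- The negative Fourier coefficients of `f` vanish, so that for integrable `f` the harmonic
extension is analytic. -/
def NegFourierVanish (f : AddCircle (2 * π) → ℂ) : Prop :=
  ∀ n : ℕ, fourierCoeff f (-((n + 1 : ℕ) : ℤ)) = 0

lemma fourierCoeff_neg_natCast (f : AddCircle (2 * π) → ℂ) (n : ℕ) :
    fourierCoeff f (-(n : ℤ)) = ∫ t, (toCircle t : ℂ) ^ n * f t ∂haarAddCircle := by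
  simp [fourierCoeff, toCircle_nsmul]

lemma fourierCoeff_natCast (f : AddCircle (2 * π) → ℂ) (n : ℕ) :
    fourierCoeff f n = ∫ t, conj (toCircle t : ℂ) ^ n * f t ∂haarAddCircle := by
  simp [fourierCoeff, toCircle_nsmul, ← Circle.coe_inv_eq_conj, toCircle_neg]

@[fun_prop]
lemma continuous_coe_toCircle : Continuous fun t : AddCircle (2 * π) ↦ (toCircle t : ℂ) :=
  continuous_subtype_val.comp continuous_toCircle

lemma norm_fourierCoeff_le (f : AddCircle (2 * π) → ℂ) (n : ℤ) :
    ‖fourierCoeff f n‖ ≤ ∫ t, ‖f t‖ ∂haarAddCircle := by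
  refine (norm_integral_le_integral_norm _).trans_eq (integral_congr_ae (.of_forall fun t ↦ ?_))
  simp

/-- Integration of an absolutely convergent power series in a unimodular function against an
integrable function, term by term. -/
lemma hasSum_integral_tsum_pow_mul {u f : AddCircle (2 * π) → ℂ} (hu : Continuous u)
    (hu1 : ∀ t, ‖u t‖ = 1) (hf : Integrable f haarAddCircle) {a : ℕ → ℂ}
    (ha : Summable fun n ↦ ‖a n‖) :
    HasSum (fun n ↦ a n * ∫ t, u t ^ n * f t ∂haarAddCircle)
      (∫ t, (∑' n, a n * u t ^ n) * f t ∂haarAddCircle) := by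
  have key := hasSum_integral_of_summable_integral_norm (μ := haarAddCircle)
    (F := fun n t ↦ a n * (u t ^ n * f t)) ?_ ?_
  · simp only [integral_const_mul] at key
    simpa only [← mul_assoc, tsum_mul_right] using key
  · intro n
    refine Integrable.const_mul ?_ _
    refine hf.bdd_mul (c := 1) (hu.pow n).aestronglyMeasurable (.of_forall fun t ↦ ?_)
    simp [hu1]
  · simp only [norm_mul, norm_pow, hu1, one_pow, one_mul, integral_const_mul]
    exact ha.mul_right _

lemma integrable_toCircle_pow_mul {f : AddCircle (2 * π) → ℂ} (hf : Integrable f haarAddCircle)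
    (n : ℕ) : Integrable (fun t ↦ (toCircle t : ℂ) ^ n * f t) haarAddCircle :=
  hf.bdd_mul (c := 1) (by fun_prop : Continuous _).aestronglyMeasurable
    (.of_forall fun t ↦ by simp)

/-! ### The harmonic extension and Fourier coefficients -/

/-- The Poisson kernel as the sum of its holomorphic and antiholomorphic parts in `w`, each a
geometric series. -/
lemma poissonKernel_eq_tsum {w z : ℂ} (hw : ‖w‖ < 1) (hz : ‖z‖ = 1) :
    (poissonKernel 0 w z : ℂ) =
      (∑' n, w ^ n * conj z ^ n) + ∑' n, conj w ^ (n + 1) * z ^ (n + 1) := by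
  have h1 : ‖w * conj z‖ < 1 := by simpa [hz] using hw
  have h2 : ‖conj w * z‖ < 1 := by simpa [hz] using hw
  have hzz : z * conj z = 1 := by rw [Complex.mul_conj']; simp [hz]
  have e1 : 1 - w * conj z ≠ 0 := fun h ↦ by
    rw [← sub_eq_zero.mp h] at h1; simp at h1
  have e2 : 1 - conj w * z ≠ 0 := fun h ↦ by
    rw [← sub_eq_zero.mp h] at h2; simp at h2
  simp only [← mul_pow]
  simp only [pow_succ, tsum_mul_right]
  rw [tsum_geometric_of_norm_lt_one h1, tsum_geometric_of_norm_lt_one h2, poissonKernel_def]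
  push_cast
  rw [← Complex.mul_conj', ← Complex.mul_conj', ← Complex.mul_conj']
  simp only [sub_zero, map_sub, hzz]
  have e3 : (z - w) * (conj z - conj w) = (1 - w * conj z) * (1 - conj w * z) := by
    linear_combination (1 - w * conj w) * hzz
  rw [e3]
  field_simp
  linear_combination w * conj w * hzz

/-- The power series whose coefficients are the nonnegative Fourier coefficients of `u`. If the
negative Fourier coefficients of `u` vanish, it is the holomorphic function on the unit disk with
boundary values `u`. -/
noncomputable def analyticExtension (u : AddCircle (2 * π) → ℂ) (w : ℂ) : ℂ :=
  ∑' n : ℕ, fourierCoeff u n * w ^ n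

/-- The harmonic extension as the sum of a power series in `w` and a power series in the
conjugate of `w`. -/
lemma harmonicExtension_eq_tsum {f : AddCircle (2 * π) → ℂ} (hf : Integrable f haarAddCircle)
    {w : ℂ} (hw : ‖w‖ < 1) :
    harmonicExtension f w = analyticExtension f w +
      ∑' n : ℕ, fourierCoeff f (-((n + 1 : ℕ) : ℤ)) * conj w ^ (n + 1) := by
  have hs : Summable fun n : ℕ ↦ ‖w ^ n‖ := by
    simpa using summable_geometric_of_lt_one (norm_nonneg w) hw
  have hs' : Summable fun n : ℕ ↦ ‖conj w ^ (n + 1)‖ := by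
    simpa using (summable_nat_add_iff 1).2 (summable_geometric_of_lt_one (norm_nonneg w) hw)
  have h1 := hasSum_integral_tsum_pow_mul (u := fun t ↦ conj (toCircle t : ℂ))
    (by fun_prop) (by simp) hf hs
  have h2 := hasSum_integral_tsum_pow_mul (u := fun t ↦ (toCircle t : ℂ))
    (f := fun t ↦ (toCircle t : ℂ) * f t) (by fun_prop) (by simp)
    (by simpa using integrable_toCircle_pow_mul hf 1) hs'
  have h1' : analyticExtension f w =
      ∫ t, (∑' n, w ^ n * conj (toCircle t : ℂ) ^ n) * f t ∂haarAddCircle := by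
    rw [← h1.tsum_eq]
    exact tsum_congr fun n ↦ by rw [fourierCoeff_natCast, mul_comm]
  have h2' : (∑' n : ℕ, fourierCoeff f (-((n + 1 : ℕ) : ℤ)) * conj w ^ (n + 1)) =
      ∫ t, (∑' n, conj w ^ (n + 1) * (toCircle t : ℂ) ^ (n + 1)) * f t ∂haarAddCircle := by
    have e : ∀ t, (∑' n, conj w ^ (n + 1) * (toCircle t : ℂ) ^ (n + 1)) * f t =
        (∑' n, conj w ^ (n + 1) * (toCircle t : ℂ) ^ n) * (toCircle t * f t) := fun t ↦ by
      simp only [pow_succ (toCircle t : ℂ), ← mul_assoc, tsum_mul_right]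
    simp only [e]
    rw [← h2.tsum_eq]
    refine tsum_congr fun n ↦ ?_
    rw [fourierCoeff_neg_natCast, mul_comm]
    simp only [pow_succ, mul_assoc]
  have hcont : ∀ (u : AddCircle (2 * π) → ℂ) (a : ℕ → ℂ) (k : ℕ), Continuous u →
      (∀ t, ‖u t‖ = 1) → Summable (fun n ↦ ‖a n‖) →
      Integrable (fun t ↦ (∑' n, a n * u t ^ (n + k)) * f t) haarAddCircle := by
    intro u a k hu hu1 ha
    refine hf.bdd_mul (c := ∑' n, ‖a n‖) (Continuous.aestronglyMeasurable ?_)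
      (.of_forall fun t ↦ tsum_of_norm_bounded ha.hasSum fun n ↦ by simp [hu1])
    exact continuous_tsum (fun n ↦ by fun_prop) ha fun n t ↦ by simp [hu1]
  rw [h1', h2', harmonicExtension, ← integral_add]
  · refine integral_congr_ae (.of_forall fun t ↦ ?_)
    simp only
    rw [poissonKernel_eq_tsum hw (norm_toCircle t), add_mul]
  · simpa using hcont (fun t ↦ conj (toCircle t : ℂ)) _ 0 (by fun_prop) (by simp) hs
  · exact hcont (fun t ↦ toCircle t) _ 1 (by fun_prop) (by simp) hs'

lemma differentiableOn_tsum_mul_pow {a : ℕ → ℂ} {M : ℝ} (ha : ∀ n, ‖a n‖ ≤ M) :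
    DifferentiableOn ℂ (fun w ↦ ∑' n, a n * w ^ n) (Metric.ball 0 1) := by
  intro w hw
  obtain ⟨r, hwr, hr⟩ := exists_between (mem_ball_zero_iff.1 hw)
  have hd := Complex.differentiableOn_tsum_of_summable_norm (F := fun n (w : ℂ) ↦ a n * w ^ n)
    (U := Metric.ball 0 r) (u := fun n ↦ M * r ^ n)
    ((summable_geometric_of_lt_one ((norm_nonneg w).trans hwr.le) hr).mul_left M)
    (fun n ↦ by fun_prop) Metric.isOpen_ball fun n z hz ↦ by
      rw [norm_mul, norm_pow]
      gcongr
      · exact (norm_nonneg _).trans (ha n)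
      · exact ha n
      · exact (mem_ball_zero_iff.1 hz).le
  exact (hd.differentiableAt
    (Metric.isOpen_ball.mem_nhds (mem_ball_zero_iff.2 hwr))).differentiableWithinAt

lemma differentiableOn_analyticExtension (u : AddCircle (2 * π) → ℂ) :
    DifferentiableOn ℂ (analyticExtension u) (Metric.ball 0 1) :=
  differentiableOn_tsum_mul_pow fun n ↦ norm_fourierCoeff_le u n

lemma summable_norm_fourierCoeff_mul_pow (u : AddCircle (2 * π) → ℂ) {w : ℂ} (hw : ‖w‖ < 1) :
    Summable fun n : ℕ ↦ ‖fourierCoeff u n * w ^ n‖ := by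
  refine .of_nonneg_of_le (fun _ ↦ norm_nonneg _) (fun n ↦ ?_)
    ((summable_geometric_of_lt_one (norm_nonneg w) hw).mul_left (∫ t, ‖u t‖ ∂haarAddCircle))
  rw [norm_mul, norm_pow]
  gcongr
  exact norm_fourierCoeff_le u n

/-- The Fourier coefficients of an absolutely convergent power series on the circle. -/
lemma fourierCoeff_tsum_pow {a : ℕ → ℂ} (ha : Summable fun n ↦ ‖a n‖) (m : ℤ) :
    fourierCoeff (fun t : AddCircle (2 * π) ↦ ∑' n, a n * (toCircle t : ℂ) ^ n) m =
      if 0 ≤ m then a m.toNat else 0 := by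
  have h := hasSum_integral_tsum_pow_mul (u := fun t ↦ (toCircle t : ℂ))
    (f := ⇑(fourier (T := 2 * π) (-m))) (by fun_prop) (by simp)
    ((map_continuous (fourier (T := 2 * π) (-m))).integrable_of_hasCompactSupport
      (HasCompactSupport.of_compactSpace _)) ha
  have e : ∀ n : ℕ, ∫ t : AddCircle (2 * π), (toCircle t : ℂ) ^ n * fourier (-m) t
      ∂haarAddCircle = if (n : ℤ) = m then 1 else 0 := by
    intro n
    have := congrFun (fourierCoeff_fourier (T := 2 * π) n) m
    rw [fourierCoeff] at this
    rw [Pi.single_apply] at this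
    simp only [eq_comm (a := m)] at this
    rw [← this]
    refine integral_congr_ae (.of_forall fun t ↦ ?_)
    simp [toCircle_nsmul, mul_comm]
  simp only [e] at h
  have h3 : fourierCoeff (fun t : AddCircle (2 * π) ↦ ∑' n, a n * (toCircle t : ℂ) ^ n) m =
      ∫ t : AddCircle (2 * π), (∑' n, a n * (toCircle t : ℂ) ^ n) * fourier (-m) t
        ∂haarAddCircle := by
    rw [fourierCoeff]
    exact integral_congr_ae (.of_forall fun t ↦ by simp [mul_comm])
  rw [h3, ← h.tsum_eq]
  split_ifs with hm
  · rw [tsum_eq_single m.toNat]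
    · simp [hm]
    · intro n hn
      rw [if_neg (by omega), mul_zero]
  · convert tsum_zero with n
    rw [if_neg (by omega), mul_zero]

/-- A function that is both holomorphic and antiholomorphic at a point has zero derivative. -/
lemma deriv_eq_zero_of_differentiableAt_comp_conj {g : ℂ → ℂ} {w : ℂ}
    (hg : DifferentiableAt ℂ g w) (hc : DifferentiableAt ℂ (fun z ↦ g (conj z)) (conj w)) :
    deriv g w = 0 := by
  have h1 := hg.hasDerivAt.hasFDerivAt.restrictScalars ℝ
  have h2 := hc.hasDerivAt.hasFDerivAt.restrictScalars ℝ
  have h3 : HasFDerivAt (fun z : ℂ ↦ conj z) (Complex.conjCLE : ℂ →L[ℝ] ℂ) (conj w) :=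
    Complex.conjCLE.hasFDerivAt
  rw [show w = conj (conj w) by simp] at h1
  have h4 := h2.unique (h1.comp (conj w) h3)
  have e1 := congrArg (fun L : ℂ →L[ℝ] ℂ ↦ L 1) h4
  have e2 := congrArg (fun L : ℂ →L[ℝ] ℂ ↦ L Complex.I) h4
  simp at e1 e2
  have : Complex.I * deriv g w = 0 := by
    rw [e1] at e2
    linear_combination e2 / 2
  simpa using this

/-- The negative Fourier coefficients of `f` are the coefficients of the antiholomorphic part of its
harmonic extension. If the extension is holomorphic, this part is both holomorphic and
antiholomorphic, hence constant. -/
theorem differentiableOn_harmonicExtension_iff {f : AddCircle (2 * π) → ℂ}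
    (hf : Integrable f haarAddCircle) :
    DifferentiableOn ℂ (harmonicExtension f) (Metric.ball 0 1) ↔ NegFourierVanish f := by
  have hA := differentiableOn_analyticExtension f
  constructor
  · intro h
    -- The antiholomorphic part is `g (conj w)`, with `b` the coefficients of `g`.
    set b : ℕ → ℂ := fun n ↦ if n = 0 then 0 else fourierCoeff f (-(n : ℤ)) with hb
    have hbM : ∀ n, ‖b n‖ ≤ ∫ t, ‖f t‖ ∂haarAddCircle := by
      intro n
      simp only [hb]
      split_ifs
      · simpa using integral_nonneg fun t ↦ norm_nonneg (f t)
      · exact norm_fourierCoeff_le f _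
    set g : ℂ → ℂ := fun w ↦ ∑' n, b n * w ^ n with hg
    have hgd : DifferentiableOn ℂ g (Metric.ball 0 1) := differentiableOn_tsum_mul_pow hbM
    have hsum : ∀ w : ℂ, ‖w‖ < 1 → Summable fun n ↦ ‖b n * w ^ n‖ := fun w hw ↦ by
      refine .of_nonneg_of_le (fun _ ↦ norm_nonneg _) (fun n ↦ ?_)
        ((summable_geometric_of_lt_one (norm_nonneg w) hw).mul_left (∫ t, ‖f t‖ ∂haarAddCircle))
      rw [norm_mul, norm_pow]
      gcongr
      exact hbM n
    have hgc : DifferentiableOn ℂ (fun w ↦ g (conj w)) (Metric.ball 0 1) := by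
      refine (h.sub hA).congr fun w hw ↦ ?_
      have hw' : ‖w‖ < 1 := mem_ball_zero_iff.1 hw
      simp only [Pi.sub_apply]
      rw [harmonicExtension_eq_tsum hf hw', add_sub_cancel_left, hg]
      simp only
      rw [(hsum (conj w) (by simpa using hw')).of_norm.tsum_eq_zero_add]
      simp [hb]
    have hconst : ∀ w ∈ Metric.ball (0 : ℂ) 1, g w = g 0 := by
      intro w hw
      refine Metric.isOpen_ball.is_const_of_deriv_eq_zero
        (convex_ball (0 : ℂ) 1).isPreconnected hgd (fun z hz ↦ ?_) hw (by simp)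
      refine deriv_eq_zero_of_differentiableAt_comp_conj
        (hgd.differentiableAt (Metric.isOpen_ball.mem_nhds hz))
        (hgc.differentiableAt (Metric.isOpen_ball.mem_nhds (by simpa using hz)))
    intro n
    have hs : Summable fun n ↦ ‖b n * ((1 / 2 : ℝ) : ℂ) ^ n‖ := hsum _ (by norm_num)
    have h1 := fourierCoeff_tsum_pow hs ((n + 1 : ℕ) : ℤ)
    have h0 := fourierCoeff_tsum_pow (a := fun k ↦ if k = 0 then g 0 else 0)
      (summable_of_ne_finset_zero (s := {0}) (by simp +contextual)) ((n + 1 : ℕ) : ℤ)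
    have e : (fun t : AddCircle (2 * π) ↦
        ∑' n, b n * ((1 / 2 : ℝ) : ℂ) ^ n * (toCircle t : ℂ) ^ n) =
        fun t ↦ ∑' k, (if k = 0 then g 0 else 0) * (toCircle t : ℂ) ^ k := by
      funext t
      rw [tsum_eq_single (f := fun k ↦ (if k = 0 then g 0 else 0) * (toCircle t : ℂ) ^ k) 0
        (by simp +contextual)]
      simp only [mul_assoc, ← mul_pow]
      simpa using hconst (((1 / 2 : ℝ) : ℂ) * toCircle t) (by simp; norm_num)
    rw [e, h0] at h1
    rw [if_pos (Int.natCast_nonneg _), if_pos (Int.natCast_nonneg _), Int.toNat_natCast,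
      if_neg n.succ_ne_zero, eq_comm, mul_eq_zero_iff_right (by simp)] at h1
    simpa only [hb, if_neg n.succ_ne_zero] using h1
  · intro h
    refine hA.congr fun w hw ↦ ?_
    rw [harmonicExtension_eq_tsum hf (mem_ball_zero_iff.1 hw)]
    simp only [h _, zero_mul, tsum_zero, add_zero]

/-! ### Square-integrable functions -/

lemma hasSum_sq_fourierCoeff_of_memLp {u : AddCircle (2 * π) → ℂ} (hu : MemLp u 2 haarAddCircle) :
    HasSum (fun n ↦ ‖fourierCoeff u n‖ ^ 2) (∫ t, ‖u t‖ ^ 2 ∂haarAddCircle) := by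
  have h := hasSum_sq_fourierCoeff (hu.toLp u)
  rw [fourierCoeff_congr_ae hu.coeFn_toLp] at h
  convert h using 1
  refine integral_congr_ae ?_
  filter_upwards [hu.coeFn_toLp] with t ht
  rw [ht]

lemma ae_eq_zero_of_fourierCoeff_eq_zero {u : AddCircle (2 * π) → ℂ}
    (hu : MemLp u 2 haarAddCircle) (h : ∀ n, fourierCoeff u n = 0) : u =ᵐ[haarAddCircle] 0 := by
  have h0 := hasSum_sq_fourierCoeff_of_memLp hu
  simp only [h, norm_zero, ne_eq, OfNat.ofNat_ne_zero, not_false_eq_true, zero_pow] at h0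
  have := (integral_eq_zero_iff_of_nonneg (fun t ↦ by positivity)
    ((memLp_two_iff_integrable_sq_norm hu.1).1 hu)).1 (h0.unique hasSum_zero)
  filter_upwards [this] with t ht
  simpa using ht

/-- The Riesz–Fischer theorem on the circle. -/
lemma exists_memLp_fourierCoeff_eq {c : ℤ → ℂ} (hc : Summable fun n ↦ ‖c n‖ ^ 2) :
    ∃ u : AddCircle (2 * π) → ℂ, MemLp u 2 haarAddCircle ∧ ∀ n, fourierCoeff u n = c n := by
  have hm : Memℓp c 2 := memℓp_gen (by simpa using hc)
  let L : Lp ℂ 2 (haarAddCircle (T := 2 * π)) := fourierBasis.repr.symm ⟨c, hm⟩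
  refine ⟨L, Lp.memLp L, fun n ↦ ?_⟩
  rw [← fourierBasis_repr, LinearIsometryEquiv.apply_symm_apply]

lemma fourierCoeff_conj (u : AddCircle (2 * π) → ℂ) (n : ℤ) :
    fourierCoeff (fun t ↦ conj (u t)) n = conj (fourierCoeff u (-n)) := by
  rw [fourierCoeff, fourierCoeff, ← integral_conj]
  refine integral_congr_ae (.of_forall fun t ↦ ?_)
  simp only [smul_eq_mul, map_mul, neg_neg, fourier_neg]

lemma fourierCoeff_sub {u v : AddCircle (2 * π) → ℂ} (hu : Integrable u haarAddCircle)
    (hv : Integrable v haarAddCircle) (n : ℤ) :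
    fourierCoeff (u - v) n = fourierCoeff u n - fourierCoeff v n := by
  have : u - v = u + (-1 : ℂ) • v := by simp [sub_eq_add_neg]
  rw [this, fourierCoeff.add hu (hv.smul _), Pi.add_apply, fourierCoeff.const_smul]
  simp [sub_eq_add_neg]

/-- The product of an analytic function on the circle with a dilate of a function holomorphic on the
disk is analytic: the dilate is an absolutely convergent power series on the circle. -/
lemma negFourierVanish_dilate_mul {Φ : ℂ → ℂ} (hΦ : DifferentiableOn ℂ Φ (Metric.ball 0 1))
    {f : AddCircle (2 * π) → ℂ} (hf : Integrable f haarAddCircle) (hneg : NegFourierVanish f)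
    {r : ℝ} (hr0 : 0 ≤ r) (hr1 : r < 1) :
    NegFourierVanish fun t ↦ Φ (r * toCircle t) * f t := by
  intro n
  have hT : ∀ w : ℂ, ‖w‖ < 1 →
      HasSum (fun k : ℕ ↦ (k.factorial : ℂ)⁻¹ * iteratedDeriv k Φ 0 * w ^ k) (Φ w) := by
    intro w hw
    have := Complex.hasSum_taylorSeries_on_ball hΦ (mem_ball_zero_iff.2 hw)
    refine this.congr_fun fun k ↦ ?_
    simp only [sub_zero, smul_eq_mul]
    ring
  have hs := (hT r (by simpa [abs_of_nonneg hr0] using hr1)).summable.norm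
  have h := (hasSum_integral_tsum_pow_mul (u := fun t ↦ (toCircle t : ℂ)) (by fun_prop) (by simp)
    (integrable_toCircle_pow_mul hf (n + 1)) hs).tsum_eq
  rw [fourierCoeff_neg_natCast]
  convert h.symm using 1
  · refine integral_congr_ae (.of_forall fun t ↦ ?_)
    have : ∑' k : ℕ, (k.factorial : ℂ)⁻¹ * iteratedDeriv k Φ 0 * (r : ℂ) ^ k * toCircle t ^ k =
        Φ (r * toCircle t) := by
      rw [← (hT (r * toCircle t) (by simpa [abs_of_nonneg hr0] using hr1)).tsum_eq]
      simp only [mul_pow, mul_assoc]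
    simp only [this]
    ring
  · symm
    convert tsum_zero with k
    have := hneg (k + n)
    rw [fourierCoeff_neg_natCast] at this
    simp only [← mul_assoc, ← pow_add]
    rw [show k + (n + 1) = k + n + 1 from rfl, this, mul_zero]

lemma re_harmonicExtension_nonneg {β : AddCircle (2 * π) → ℝ} (hβ : ∀ t, 0 ≤ β t) {w : ℂ}
    (hw : ‖w‖ < 1) : 0 ≤ (harmonicExtension (fun t ↦ (β t : ℂ)) w).re := by
  rw [harmonicExtension]
  simp only [← Complex.ofReal_mul]
  rw [integral_complex_ofReal, Complex.ofReal_re]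
  refine integral_nonneg fun t ↦ mul_nonneg ?_ (hβ t)
  rw [poissonKernel_def]
  refine div_nonneg ?_ (by positivity)
  simp
  nlinarith [norm_nonneg w]

/-! ### Boundary values and the analytic completion -/

/-- Radial boundary values: along a sequence of radii, the dilates of the analytic extension of an
analytic `u ∈ L²` converge to `u` almost everywhere. This comes from convergence in `L²`, which
Parseval's identity reduces to dominated convergence of a series. -/
theorem exists_seq_tendsto_analyticExtension {u : AddCircle (2 * π) → ℂ}
    (hu : MemLp u 2 haarAddCircle) (hneg : ∀ n < 0, fourierCoeff u n = 0) :
    ∃ r : ℕ → ℝ, (∀ j, 0 ≤ r j) ∧ (∀ j, r j < 1) ∧ ∀ᵐ t ∂haarAddCircle,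
      Tendsto (fun j ↦ analyticExtension u (r j * toCircle t)) atTop (𝓝 (u t)) := by
  set r : ℕ → ℝ := fun j ↦ 1 - 1 / ((j : ℝ) + 1) with hr
  have hr0 : ∀ j, 0 ≤ r j := fun j ↦ by
    have : 1 / ((j : ℝ) + 1) ≤ 1 := by
      rw [div_le_one (by positivity)]; linarith [(Nat.cast_nonneg j : (0 : ℝ) ≤ j)]
    simpa [hr] using this
  have hr1 : ∀ j, r j < 1 := fun j ↦ by
    have : 0 < 1 / ((j : ℝ) + 1) := by positivity
    simp only [hr]; linarith
  have hrt : Tendsto r atTop (𝓝 1) := by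
    simpa [hr] using tendsto_const_nhds.sub (tendsto_one_div_add_atTop_nhds_zero_nat (𝕜 := ℝ))
  have hnorm : ∀ j (t : AddCircle (2 * π)), ‖(r j : ℂ) * toCircle t‖ < 1 := fun j t ↦ by
    simpa [abs_of_nonneg (hr0 j)] using hr1 j
  let v : ℕ → AddCircle (2 * π) → ℂ := fun j t ↦ analyticExtension u (r j * toCircle t)
  have hecont : ∀ j, Continuous (v j) := fun j ↦
    (differentiableOn_analyticExtension u).continuousOn.comp_continuous (by fun_prop)
      fun t ↦ mem_ball_zero_iff.2 (hnorm j t)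
  have heL : ∀ j, MemLp (v j) 2 haarAddCircle :=
    fun j ↦ (hecont j).memLp_of_hasCompactSupport (HasCompactSupport.of_compactSpace _)
  have hecoeff : ∀ j m, fourierCoeff (v j) m = fourierCoeff u m * (r j : ℂ) ^ m.toNat := by
    intro j m
    have h := fourierCoeff_tsum_pow (summable_norm_fourierCoeff_mul_pow u (w := r j)
      (by simpa [abs_of_nonneg (hr0 j)] using hr1 j)) m
    simp only [v, analyticExtension, mul_pow, ← mul_assoc]
    rw [h]
    split_ifs with hm
    · rw [Int.toNat_of_nonneg hm]
    · simp [hneg m (not_le.1 hm)]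
  have hL2 : Tendsto (fun j ↦ ∫ t, ‖v j t - u t‖ ^ 2 ∂haarAddCircle) atTop (𝓝 0) := by
    have h1 : ∀ j, ∫ t, ‖v j t - u t‖ ^ 2 ∂haarAddCircle =
        ∑' m, ‖fourierCoeff u m * ((r j : ℂ) ^ m.toNat - 1)‖ ^ 2 := by
      intro j
      have := (hasSum_sq_fourierCoeff_of_memLp ((heL j).sub hu)).tsum_eq
      simp only [fourierCoeff_sub ((heL j).integrable one_le_two) (hu.integrable one_le_two),
        hecoeff, Pi.sub_apply] at this
      rw [← this]
      simp only [mul_sub, mul_one]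
    simp only [h1]
    rw [← tsum_zero (α := ℝ) (β := ℤ) (L := .unconditional ℤ)]
    refine tendsto_tsum_of_dominated_convergence
      (hasSum_sq_fourierCoeff_of_memLp hu).summable (fun m ↦ ?_) (.of_forall fun j m ↦ ?_)
    · have : Tendsto (fun j ↦ ((r j : ℝ) : ℂ)) atTop (𝓝 ((1 : ℝ) : ℂ)) :=
        (Complex.continuous_ofReal.tendsto 1).comp hrt
      simpa using (((this.pow m.toNat).sub_const 1).const_mul (fourierCoeff u m)).norm.pow 2
    · rw [Real.norm_of_nonneg (by positivity)]
      have : ‖(r j : ℂ) ^ m.toNat - 1‖ ≤ 1 := by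
        rw [← Complex.ofReal_pow, ← Complex.ofReal_one, ← Complex.ofReal_sub, Complex.norm_real,
          Real.norm_eq_abs, abs_le]
        constructor <;> linarith [pow_nonneg (hr0 j) m.toNat,
          pow_le_one₀ (hr0 j) (hr1 j).le (n := m.toNat)]
      rw [norm_mul]
      gcongr
      exact mul_le_of_le_one_right (norm_nonneg _) this
  have hLp : Tendsto (fun j ↦ eLpNorm (v j - u) 2 haarAddCircle) atTop (𝓝 0) := by
    have h1 : ∀ j, eLpNorm (v j - u) 2 haarAddCircle =
        ENNReal.ofReal ((∫ t, ‖v j t - u t‖ ^ 2 ∂haarAddCircle) ^ (2 : ℝ)⁻¹) := fun j ↦ by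
      rw [((heL j).sub hu).eLpNorm_eq_integral_rpow_norm two_ne_zero ENNReal.ofNat_ne_top]
      simp
    simp only [h1]
    have := ENNReal.tendsto_ofReal (hL2.rpow_const (p := (2 : ℝ)⁻¹) (Or.inr (by norm_num)))
    simpa using this
  obtain ⟨ns, -, hns⟩ := (tendstoInMeasure_of_tendsto_eLpNorm two_ne_zero
    (fun j ↦ (heL j).1) hu.1 hLp).exists_seq_tendsto_ae
  exact ⟨r ∘ ns, fun j ↦ hr0 _, fun j ↦ hr1 _, hns⟩

/-- The analytic completion of a real function `β ∈ L²`: a function `E` with vanishing negative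
Fourier coefficients and real part `β`. Its other coefficients are twice those of `β`, except for
the mean, and this gives the bound on its norm. -/
theorem exists_analytic_completion {β : AddCircle (2 * π) → ℝ} (hβ : MemLp β 2 haarAddCircle) :
    ∃ E : AddCircle (2 * π) → ℂ, MemLp E 2 haarAddCircle ∧
      (∀ n < 0, fourierCoeff E n = 0) ∧
      (∀ᵐ t ∂haarAddCircle, (E t).re = β t) ∧
      (∫ t, ‖E t‖ ^ 2 ∂haarAddCircle ≤ 4 * ∫ t, β t ^ 2 ∂haarAddCircle) ∧
      ∀ w, ‖w‖ < 1 →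
        (analyticExtension E w).re = (harmonicExtension (fun t ↦ (β t : ℂ)) w).re := by
  set b : AddCircle (2 * π) → ℂ := fun t ↦ (β t : ℂ) with hb
  have hbL : MemLp b 2 haarAddCircle := hβ.ofReal
  have hbI : Integrable b haarAddCircle := hbL.integrable one_le_two
  have hbconj : ∀ n, fourierCoeff b (-n) = conj (fourierCoeff b n) := fun n ↦ by
    have := fourierCoeff_conj b (-n)
    simpa [hb] using this
  set c : ℤ → ℂ := fun n ↦ if n = 0 then fourierCoeff b 0 else
    if 0 < n then 2 * fourierCoeff b n else 0 with hc
  have hcb : ∀ n, ‖c n‖ ≤ 2 * ‖fourierCoeff b n‖ := fun n ↦ by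
    simp only [hc]
    split_ifs with h1 h2
    · rw [h1]; linarith [norm_nonneg (fourierCoeff b 0)]
    · simp
    · simp
  have hcsq : ∀ n, ‖c n‖ ^ 2 ≤ 4 * ‖fourierCoeff b n‖ ^ 2 := fun n ↦ by
    nlinarith [hcb n, norm_nonneg (c n)]
  have hbs := hasSum_sq_fourierCoeff_of_memLp hbL
  have hcs : Summable fun n ↦ ‖c n‖ ^ 2 :=
    .of_nonneg_of_le (fun n ↦ by positivity) hcsq (hbs.summable.mul_left 4)
  obtain ⟨E, hE, hEc⟩ := exists_memLp_fourierCoeff_eq hcs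
  have hEI : Integrable E haarAddCircle := hE.integrable one_le_two
  have hEs := hasSum_sq_fourierCoeff_of_memLp hE
  simp only [hEc] at hEs
  have hstar : MemLp (fun t ↦ conj (E t)) 2 haarAddCircle := hE.star
  have hre : ∀ᵐ t ∂haarAddCircle, (E t).re = β t := by
    have h0 : (E - ((2 : ℂ) • b - fun t ↦ conj (E t))) =ᵐ[haarAddCircle] 0 := by
      refine ae_eq_zero_of_fourierCoeff_eq_zero
        (hE.sub ((hbL.const_smul 2).sub hstar)) fun n ↦ ?_
      rw [fourierCoeff_sub hEI ((hbI.smul _).sub (hstar.integrable one_le_two)),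
        fourierCoeff_sub (hbI.smul _) (hstar.integrable one_le_two),
        fourierCoeff.const_smul, fourierCoeff_conj, hEc, hEc]
      rcases lt_trichotomy n 0 with hn | rfl | hn
      · simp [hc, hn.ne, hn.not_gt, hn, hbconj, map_ofNat]
      · have := hbconj 0
        simp only [neg_zero] at this
        simp only [hc, smul_eq_mul, neg_zero, if_true, ← this]
        ring
      · simp [hc, hn.ne', hn.not_gt, hn]
    filter_upwards [h0] with t ht
    have := congrArg Complex.re ht
    simp [hb] at this
    linarith
  refine ⟨E, hE, fun n hn ↦ ?_, hre, ?_, fun w hw ↦ ?_⟩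
  · simp [hEc, hc, hn.ne, hn.not_gt]
  · have := hasSum_le hcsq hEs (hbs.mul_left 4)
    simpa [hb] using this
  · have s1 := (summable_norm_fourierCoeff_mul_pow b hw).of_norm
    have s2 := (summable_norm_fourierCoeff_mul_pow E hw).of_norm
    simp only [hEc] at s2
    rw [harmonicExtension_eq_tsum hbI hw]
    simp only [analyticExtension, hEc]
    rw [s1.tsum_eq_zero_add, s2.tsum_eq_zero_add]
    have e1 : ∑' n : ℕ, c ((n + 1 : ℕ) : ℤ) * w ^ (n + 1) =
        2 * ∑' n : ℕ, fourierCoeff b ((n + 1 : ℕ) : ℤ) * w ^ (n + 1) := by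
      rw [← tsum_mul_left]
      refine tsum_congr fun n ↦ ?_
      simp only [hc]
      rw [if_neg (by positivity), if_pos (by positivity), mul_assoc]
    have e2 : ∑' n : ℕ, fourierCoeff b (-((n + 1 : ℕ) : ℤ)) * conj w ^ (n + 1) =
        conj (∑' n : ℕ, fourierCoeff b ((n + 1 : ℕ) : ℤ) * w ^ (n + 1)) := by
      rw [Complex.conj_tsum]
      exact tsum_congr fun n ↦ by rw [hbconj]; simp
    change _ = (_ + ∑' n : ℕ, fourierCoeff b (-((n + 1 : ℕ) : ℤ)) * conj w ^ (n + 1)).re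
    rw [e1, e2]
    simp [hc]
    ring

/-- Products with powers of `(1 + E)⁻¹` keep an integrable function analytic, for `E ∈ L²` analytic
with nonnegative real part: pass to the limit in the products with the dilates of the bounded
holomorphic function `(1 + E)⁻¹ ^ k`. -/
theorem negFourierVanish_inv_pow_mul {E : AddCircle (2 * π) → ℂ} (hE : MemLp E 2 haarAddCircle)
    (hEneg : ∀ n < 0, fourierCoeff E n = 0)
    (hext : ∀ w, ‖w‖ < 1 → 0 ≤ (analyticExtension E w).re)
    (hre : ∀ᵐ t ∂haarAddCircle, 0 ≤ (E t).re)
    {f : AddCircle (2 * π) → ℂ} (hf : Integrable f haarAddCircle) (hneg : NegFourierVanish f)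
    (k : ℕ) : NegFourierVanish fun t ↦ (1 + E t)⁻¹ ^ k * f t := by
  intro n
  obtain ⟨r, hr0, hr1, hr⟩ := exists_seq_tendsto_analyticExtension hE hEneg
  have hnorm : ∀ j (t : AddCircle (2 * π)), ‖(r j : ℂ) * toCircle t‖ < 1 := fun j t ↦ by
    simpa [abs_of_nonneg (hr0 j)] using hr1 j
  have hed := differentiableOn_analyticExtension E
  have hone : ∀ x : ℂ, 0 ≤ x.re → 1 ≤ ‖1 + x‖ := fun x hx ↦ by
    have := Complex.re_le_norm (1 + x)
    simp at this
    linarith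
  have hΦ : DifferentiableOn ℂ (fun w ↦ (1 + analyticExtension E w)⁻¹ ^ k) (Metric.ball 0 1) := by
    refine ((hed.const_add 1).inv fun w hw ↦ ?_).pow k
    exact norm_pos_iff.1 (one_pos.trans_le (hone _ (hext w (mem_ball_zero_iff.1 hw))))
  have hzero : ∀ i, ∫ t, (toCircle t : ℂ) ^ (n + 1) *
      ((1 + analyticExtension E (r i * toCircle t))⁻¹ ^ k * f t) ∂haarAddCircle = 0 := fun i ↦ by
    rw [← fourierCoeff_neg_natCast]
    exact negFourierVanish_dilate_mul hΦ hf hneg (hr0 _) (hr1 _) n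
  rw [fourierCoeff_neg_natCast]
  refine tendsto_nhds_unique (tendsto_integral_of_dominated_convergence (fun t ↦ ‖f t‖)
    (fun i ↦ ?_) hf.norm (fun i ↦ .of_forall fun t ↦ ?_) ?_)
    (tendsto_const_nhds.congr fun i ↦ (hzero i).symm)
  · refine (Continuous.aestronglyMeasurable (by fun_prop)).mul
      (Continuous.aestronglyMeasurable ?_ |>.mul hf.1)
    refine ((continuous_const.add (hed.continuousOn.comp_continuous (by fun_prop)
      fun t ↦ mem_ball_zero_iff.2 (hnorm i t))).inv₀ fun t ↦ ?_).pow k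
    exact norm_pos_iff.1 (one_pos.trans_le (hone _ (hext _ (hnorm _ t))))
  · rw [norm_mul, norm_mul, norm_pow, norm_pow, norm_toCircle, one_pow, one_mul, norm_inv]
    exact mul_le_of_le_one_left (norm_nonneg _)
      (pow_le_one₀ (by positivity) (inv_le_one_of_one_le₀ (hone _ (hext _ (hnorm _ t)))))
  · filter_upwards [hr, hre] with t ht hret
    refine tendsto_const_nhds.mul (Tendsto.mul_const _ (((ht.const_add 1).inv₀ ?_).pow k))
    exact norm_pos_iff.1 (one_pos.trans_le (hone _ hret))

/-! ### The decomposition -/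

lemma sq_sqrt_max_sub_one_le_rpow {p : ℝ} (hp : 1 ≤ p) {x : ℝ} (hx : 0 ≤ x) :
    (√(max x 1) - 1) ^ 2 ≤ x ^ p := by
  rcases le_total x 1 with h | h
  · simpa [max_eq_right h] using Real.rpow_nonneg hx p
  · rw [max_eq_left h]
    have h1 := Real.one_le_sqrt.2 h
    have h2 := Real.sq_sqrt hx
    have h3 := Real.self_le_rpow_of_one_le h hp
    nlinarith

/-- The pointwise estimates behind the decomposition, with `x` the size of the function and
`G = (1 + E)⁻¹`, where `|G| ^ 2 ≤ min 1 (1 / x)`. The first multiplier is the complement of the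
second one, which is quadratically small in `E`. -/
lemma multiplier_bounds {p : ℝ} (hp : 1 ≤ p) {x : ℝ} (hx : 0 ≤ x) {E : ℂ}
    (hE : E.re = √(max x 1) - 1) :
    ‖(1 + E)⁻¹‖ ≤ 1 ∧
    x * ‖2 * (1 + E)⁻¹ ^ 2 - (1 + E)⁻¹ ^ 4‖ ≤ 3 ∧
    x * ‖(1 - (1 + E)⁻¹ ^ 2) ^ 2‖ ≤ 4 * ‖E‖ ^ 2 + 4 * x ^ p := by
  have h1 : √(max x 1) ≤ ‖1 + E‖ := by
    have := Complex.re_le_norm (1 + E)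
    simp only [Complex.add_re, Complex.one_re, hE] at this
    linarith
  have h2 : max x 1 ≤ ‖1 + E‖ ^ 2 := (Real.sqrt_le_left (norm_nonneg _)).1 h1
  have h3 : 1 ≤ ‖1 + E‖ := (Real.one_le_sqrt.2 (le_max_right x 1)).trans h1
  have hne : 1 + E ≠ 0 := norm_pos_iff.1 (one_pos.trans_le h3)
  set G := (1 + E)⁻¹ with hG
  have hG1 : ‖G‖ ≤ 1 := by rw [hG, norm_inv]; exact inv_le_one_of_one_le₀ h3
  have hxG : x * ‖G‖ ^ 2 ≤ 1 := by
    rw [hG, norm_inv, inv_pow, mul_inv_le_iff₀ (by positivity), one_mul]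
    exact (le_max_left _ _).trans h2
  have hG2 : ‖G ^ 2‖ ≤ 1 := by rw [norm_pow]; exact pow_le_one₀ (norm_nonneg _) hG1
  refine ⟨hG1, ?_, ?_⟩
  · have e : 2 * G ^ 2 - G ^ 4 = G ^ 2 * (2 - G ^ 2) := by ring
    have : ‖2 - G ^ 2‖ ≤ 3 := (norm_sub_le _ _).trans (by rw [Complex.norm_ofNat]; linarith)
    rw [e, norm_mul, ← mul_assoc, norm_pow]
    calc x * ‖G‖ ^ 2 * ‖2 - G ^ 2‖ ≤ 1 * 3 := by gcongr
      _ = 3 := one_mul 3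
  · have hle2 : ‖1 - G ^ 2‖ ≤ 2 := (norm_sub_le _ _).trans (by rw [norm_one]; linarith)
    have hleE : ‖1 - G ^ 2‖ ≤ 2 * ‖E‖ := by
      have e : 1 - G ^ 2 = E * G * (1 + G) := by
        rw [hG]; field_simp; ring
      have : ‖1 + G‖ ≤ 2 := (norm_add_le _ _).trans (by rw [norm_one]; linarith)
      rw [e, norm_mul, norm_mul]
      calc ‖E‖ * ‖G‖ * ‖1 + G‖ ≤ ‖E‖ * 1 * 2 := by gcongr
        _ = 2 * ‖E‖ := by ring
    rw [norm_pow]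
    rcases le_total x 1 with h | h
    · have := Real.rpow_nonneg hx p
      have h4 : ‖1 - G ^ 2‖ ^ 2 ≤ (2 * ‖E‖) ^ 2 := by gcongr
      have h5 : x * ‖1 - G ^ 2‖ ^ 2 ≤ 1 * ‖1 - G ^ 2‖ ^ 2 := by gcongr
      linarith [mul_pow 2 ‖E‖ 2]
    · have := Real.self_le_rpow_of_one_le h hp
      have h4 : ‖1 - G ^ 2‖ ^ 2 ≤ 2 ^ 2 := by gcongr
      have h5 : x * ‖1 - G ^ 2‖ ^ 2 ≤ x * 2 ^ 2 := by gcongr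
      nlinarith [sq_nonneg ‖E‖]

theorem theorem1 (p : ℝ) (hp : 1 < p) :
    ∃ C : ℝ, 0 < C ∧
      ∀ lam : ℝ, 0 < lam →
        ∀ f : AddCircle (2 * π) → ℂ,
          MemHardy (ENNReal.ofReal p) f →
          eLpNorm f (ENNReal.ofReal p) haarAddCircle = 1 →
          ∃ f₀ f₁ : AddCircle (2 * π) → ℂ,
            MemHardy 1 f₀ ∧ MemHardy ∞ f₁ ∧ f = f₀ + f₁ ∧
            eLpNorm f₁ ∞ haarAddCircle ≤ ENNReal.ofReal lam ∧
            eLpNorm f₀ 1 haarAddCircle ≤ ENNReal.ofReal (C * lam ^ (1 - p)) := by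
  refine ⟨20 * 3 ^ (p - 1), by positivity, fun lam hlam f ⟨hfp, hfd⟩ hf1 ↦ ?_⟩
  have hp0 : 0 < p := one_pos.trans hp
  have hfI : Integrable f haarAddCircle := hfp.integrable (by simpa using hp.le)
  have hfneg : NegFourierVanish f := (differentiableOn_harmonicExtension_iff hfI).1 hfd
  -- The multiplier of `f₁` is at most `3 μ / ‖f‖`, so `μ = λ / 3`.
  obtain ⟨μ, hμ, rfl⟩ : ∃ μ : ℝ, 0 < μ ∧ lam = 3 * μ := ⟨lam / 3, by positivity, by ring⟩
  set x : AddCircle (2 * π) → ℝ := fun t ↦ ‖f t‖ / μ with hx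
  have hx0 : ∀ t, 0 ≤ x t := fun t ↦ by positivity
  have hxf : ∀ t, ‖f t‖ = μ * x t := fun t ↦ by simp only [hx]; field_simp
  have hxm : AEStronglyMeasurable x haarAddCircle := by
    simpa only [hx, div_eq_mul_inv] using hfI.1.norm.mul_const μ⁻¹
  have hfpow : ∫ t, ‖f t‖ ^ p ∂haarAddCircle = 1 := by
    have h := hfp.eLpNorm_eq_integral_rpow_norm (by simpa using hp0) ENNReal.ofReal_ne_top
    rw [hf1, ENNReal.toReal_ofReal hp0.le, eq_comm, ENNReal.ofReal_eq_one,
      Real.rpow_inv_eq (integral_nonneg fun t ↦ by positivity) one_pos.le hp0.ne',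
      Real.one_rpow] at h
    exact h
  have hxpow : ∀ t, x t ^ p = μ ^ (-p) * ‖f t‖ ^ p := fun t ↦ by
    simp only [hx]
    rw [Real.div_rpow (norm_nonneg _) hμ.le, Real.rpow_neg hμ.le, div_eq_inv_mul]
  have hxI : Integrable (fun t ↦ x t ^ p) haarAddCircle := by
    simp only [hxpow]
    have := hfp.integrable_norm_rpow (by simpa using hp0) ENNReal.ofReal_ne_top
    rw [ENNReal.toReal_ofReal hp0.le] at this
    exact this.const_mul _
  have hxint : ∫ t, x t ^ p ∂haarAddCircle = μ ^ (-p) := by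
    simp only [hxpow, integral_const_mul, hfpow, mul_one]
  set β : AddCircle (2 * π) → ℝ := fun t ↦ √(max (x t) 1) - 1 with hβ
  have hβ0 : ∀ t, 0 ≤ β t := fun t ↦ sub_nonneg.2 (Real.one_le_sqrt.2 (le_max_right _ _))
  have hβm : AEStronglyMeasurable β haarAddCircle :=
    (by fun_prop : Continuous fun y : ℝ ↦ √(max y 1) - 1).comp_aestronglyMeasurable hxm
  have hβx : ∀ t, β t ^ 2 ≤ x t ^ p := fun t ↦ sq_sqrt_max_sub_one_le_rpow hp.le (hx0 t)
  have hβI : Integrable (fun t ↦ β t ^ 2) haarAddCircle :=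
    hxI.mono' (hβm.pow 2) (.of_forall fun t ↦ by
      rw [Real.norm_of_nonneg (by positivity)]; exact hβx t)
  have hβL : MemLp β 2 haarAddCircle := (memLp_two_iff_integrable_sq hβm).2 hβI
  obtain ⟨E, hE, hEneg, hre, hEnorm, hext⟩ := exists_analytic_completion hβL
  have hEI : Integrable (fun t ↦ ‖E t‖ ^ 2) haarAddCircle :=
    (memLp_two_iff_integrable_sq_norm hE.1).1 hE
  have hbd : ∀ᵐ t ∂haarAddCircle, ‖(1 + E t)⁻¹‖ ≤ 1 ∧
      x t * ‖2 * (1 + E t)⁻¹ ^ 2 - (1 + E t)⁻¹ ^ 4‖ ≤ 3 ∧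
      x t * ‖(1 - (1 + E t)⁻¹ ^ 2) ^ 2‖ ≤ 4 * ‖E t‖ ^ 2 + 4 * x t ^ p := by
    filter_upwards [hre] with t ht using multiplier_bounds hp.le (hx0 t) ht
  have hmul : ∀ k, NegFourierVanish fun t ↦ (1 + E t)⁻¹ ^ k * f t :=
    negFourierVanish_inv_pow_mul hE hEneg
      (fun w hw ↦ hext w hw ▸ re_harmonicExtension_nonneg hβ0 hw)
      (hre.mono fun t ht ↦ ht ▸ hβ0 t) hfI hfneg
  have hGm : AEStronglyMeasurable (fun t ↦ (1 + E t)⁻¹) haarAddCircle :=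
    (hE.1.aemeasurable.const_add 1).inv.aestronglyMeasurable
  have hGI : ∀ k, Integrable (fun t ↦ (1 + E t)⁻¹ ^ k * f t) haarAddCircle := fun k ↦
    hfI.bdd_mul (c := 1) (hGm.pow k) (hbd.mono fun t ht ↦ by
      rw [norm_pow]; exact pow_le_one₀ (norm_nonneg _) ht.1)
  set f₁ : AddCircle (2 * π) → ℂ :=
    (2 : ℂ) • (fun t ↦ (1 + E t)⁻¹ ^ 2 * f t) - fun t ↦ (1 + E t)⁻¹ ^ 4 * f t with hf₁
  have hf₁I : Integrable f₁ haarAddCircle := ((hGI 2).smul _).sub (hGI 4)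
  have hf₁neg : NegFourierVanish f₁ := fun n ↦ by
    rw [hf₁, fourierCoeff_sub ((hGI 2).smul _) (hGI 4), fourierCoeff.const_smul, hmul 2 n,
      hmul 4 n, smul_zero, sub_zero]
  have hf₁bd : ∀ᵐ t ∂haarAddCircle, ‖f₁ t‖ ≤ 3 * μ := by
    filter_upwards [hbd] with t ht
    have : f₁ t = (2 * (1 + E t)⁻¹ ^ 2 - (1 + E t)⁻¹ ^ 4) * f t := by
      simp only [hf₁, Pi.sub_apply, Pi.smul_apply, smul_eq_mul]; ring
    rw [this, norm_mul, hxf]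
    nlinarith [ht.2.1]
  have hf₀neg : NegFourierVanish (f - f₁) := fun n ↦ by
    rw [fourierCoeff_sub hfI hf₁I, hfneg n, hf₁neg n, sub_zero]
  have hf₀I : Integrable (f - f₁) haarAddCircle := hfI.sub hf₁I
  refine ⟨f - f₁, f₁, ⟨memLp_one_iff_integrable.2 hf₀I,
      (differentiableOn_harmonicExtension_iff hf₀I).2 hf₀neg⟩,
    ⟨memLp_top_of_bound hf₁I.1 _ hf₁bd, (differentiableOn_harmonicExtension_iff hf₁I).2 hf₁neg⟩,
    (sub_add_cancel f f₁).symm, ?_, ?_⟩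
  · rw [eLpNorm_exponent_top]
    exact eLpNormEssSup_le_of_ae_bound hf₁bd
  · rw [eLpNorm_one_eq_lintegral_enorm, ← ofReal_integral_norm_eq_lintegral_enorm hf₀I]
    refine ENNReal.ofReal_le_ofReal ?_
    calc ∫ t, ‖(f - f₁) t‖ ∂haarAddCircle
        ≤ ∫ t, μ * (4 * ‖E t‖ ^ 2 + 4 * x t ^ p) ∂haarAddCircle := by
          refine integral_mono_ae hf₀I.norm
            (((hEI.const_mul 4).add (hxI.const_mul 4)).const_mul μ) ?_
          filter_upwards [hbd] with t ht
          have : (f - f₁) t = (1 - (1 + E t)⁻¹ ^ 2) ^ 2 * f t := by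
            simp only [hf₁, Pi.sub_apply, Pi.smul_apply, smul_eq_mul]; ring
          rw [this, norm_mul, hxf, mul_comm, mul_assoc]
          exact mul_le_mul_of_nonneg_left ht.2.2 hμ.le
      _ = μ * (4 * ∫ t, ‖E t‖ ^ 2 ∂haarAddCircle + 4 * μ ^ (-p)) := by
          rw [integral_const_mul, integral_add (hEI.const_mul 4) (hxI.const_mul 4),
            integral_const_mul, integral_const_mul, hxint]
      _ ≤ μ * (4 * (4 * μ ^ (-p)) + 4 * μ ^ (-p)) := by
          have : ∫ t, β t ^ 2 ∂haarAddCircle ≤ μ ^ (-p) :=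
            hxint ▸ integral_mono hβI hxI hβx
          refine mul_le_mul_of_nonneg_left ?_ hμ.le
          linarith
      _ = 20 * 3 ^ (p - 1) * (3 * μ) ^ (1 - p) := by
          have h3 : (3 : ℝ) ^ (p - 1) * 3 ^ (1 - p) = 1 := by
            rw [← Real.rpow_add (by norm_num)]; simp
          have hμp : μ ^ (1 - p) = μ * μ ^ (-p) := by
            rw [sub_eq_add_neg, Real.rpow_add hμ, Real.rpow_one]
          rw [Real.mul_rpow (by norm_num) hμ.le, hμp]
          linear_combination (-20 * μ * μ ^ (-p)) * h3
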